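/- For $s>0$ let $$\xi_0(s)=\int_0^1\frac{1-x}{1+x}\,s\,x^{s-1}\,dx ,$$ equivalently $\xi_0(s)=2\,{}_2F_1(1,s;s+1;-1)-1$. Let $P_0=(s_0,t_0)$ with $s_0>0$ and $0\le t_0<1$. Consider the following three curves. - The forward extremal curve: $t_{\uparrow,P_0}(s)=t_0+(1-t_0)\left(1-\frac{s_0}{s}\right)\xi_0(s_0)$ for $s\ge s_0$. - The backward extremal curve: for $0<s\le s_0$, $t=t_{\downarrow,P_0}(s)$ is the solution of $t_0=t+(1-t)\left(1-\frac{s}{s_0}\right)\xi_0(s)$. - The curve of infinitesimally sharp inclusions: $t_{P_0}(s)=1-(1-t_0)\exp\left[-\int_{s_0}^s\frac{\xi_0(\sigma)}{\sigma}\,d\sigma\right]$ for $s>0$. Then the integral in the definition of $t_{P_0}(s)$ converges for every $s>0$; the equation defining $t_{\downarrow,P_0}(s)$ has exactly one solution $t\in\mathbb{R}$ for every $0<s<s_0$; and 1. $t_{P_0}(s)<t_{\uparrow,P_0}(s)$ for every $s>s_0$; 2. $t_{\downarrow,P_0}(s)<t_{P_0}(s)$ for every $0<s<s_0$. -/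

import Mathlib

open MeasureTheory

/-- The integrand `x ↦ (1 - x) / (1 + x) * s * x ^ (s - 1)` of the integral that defines `ξ₀(s)`. -/
noncomputable def xiIntegrand (s x : ℝ) : ℝ := (1 - x) / (1 + x) * (s * x ^ (s - 1))

/-- `ξ₀(s) = ∫₀¹ (1 - x) / (1 + x) * s * x ^ (s - 1) dx` for `s > 0`. By the Euler integral this is
`2 * F(1, s; s + 1; -1) - 1`, where `F` is the Gauss hypergeometric function. -/
noncomputable def xi0 (s : ℝ) : ℝ := ∫ x in (0 : ℝ)..1, xiIntegrand s x

/-- The integral that defines `ξ₀(s)` converges for every `s > 0`. -/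
theorem xiIntegrand_intervalIntegrable (s : ℝ) (hs : 0 < s) :
    IntervalIntegrable (xiIntegrand s) volume 0 1 := by
  have h1 : IntervalIntegrable (fun x : ℝ => s * x ^ (s - 1)) volume 0 1 :=
    (intervalIntegral.intervalIntegrable_rpow' (by linarith)).const_mul s
  refine IntervalIntegrable.continuousOn_mul (g := fun x : ℝ => (1 - x) / (1 + x)) h1 ?_
  intro x hx
  rw [Set.uIcc_of_le zero_le_one] at hx
  have hx1 : (1 : ℝ) + x ≠ 0 := by linarith [hx.1]
  exact ((continuousAt_const.sub continuousAt_id).div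
    (continuousAt_const.add continuousAt_id) hx1).continuousWithinAt

/-- The parameter domain `Ω = {(s, t) : s ∈ [0, ∞), t ∈ [0, 1)}`. -/
def OmegaSet : Set (ℝ × ℝ) := {P | 0 ≤ P.1 ∧ 0 ≤ P.2 ∧ P.2 < 1}

/-- The forward extremal curve `s ↦ t_{↑,P₀}(s)`, considered for `s ≥ s₀`, where `P₀ = (s₀, t₀)`. -/
noncomputable def tForward (P₀ : ℝ × ℝ) (s : ℝ) : ℝ :=
  P₀.2 + (1 - P₀.2) * (1 - P₀.1 / s) * xi0 P₀.1

/-- `(s, t)` lies on the backward extremal curve of `P₀ = (s₀, t₀)`: the number `t` solves the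
equation `t₀ = t + (1 - t) * (1 - s / s₀) * ξ₀(s)`, which defines `t_{↓,P₀}(s)` implicitly
for `s ≤ s₀`. -/
def IsBackwardValue (P₀ : ℝ × ℝ) (s t : ℝ) : Prop :=
  P₀.2 = t + (1 - t) * (1 - s / P₀.1) * xi0 s

/-- The curve of infinitesimally sharp inclusions
`t_{P₀}(s) = 1 - (1 - t₀) * exp (- ∫_{s₀}^s ξ₀(σ) / σ dσ)`. -/
noncomputable def tSharp (P₀ : ℝ × ℝ) (s : ℝ) : ℝ :=
  1 - (1 - P₀.2) * Real.exp (-∫ σ in P₀.1..s, xi0 σ / σ)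

/-! Put `B_n(s) = ∫₀¹ x^s / (1 + x)^n dx`. Then `ξ₀ = 2 B₂` and `1 - ξ₀ = 2 s B₁`, so `(1/ξ₀(s) -
1)/s = B₁(s)/B₂(s)`, which strictly increases by a Chebyshev argument (`betaMoment_mul_lt`).
Freezing this quotient at its value at `a` gives a function that exceeds `ξ₀` for `s > a`
(`xi0_lt_div`). With that function in place of `ξ₀`, the sharp curve from `a` becomes exactly the
forward extremal curve, so integrating the bound yields `one_sub_mul_xi0_lt_exp`. The forward claim
is this inequality from `s₀` to `s`; the backward claim is the same inequality from `s` to `s₀`. -/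

theorem betaMoment_integrand_continuousOn (n : ℕ) {s : ℝ} (hs : 0 ≤ s) :
    ContinuousOn (fun x : ℝ => x ^ s / (1 + x) ^ n) (Set.Icc 0 1) := by
  refine ContinuousOn.div (Real.continuous_rpow_const hs).continuousOn (by fun_prop) ?_
  intro x hx
  have := hx.1
  positivity

/-- The moments `∫₀¹ x ^ s / (1 + x) ^ n dx`. -/
noncomputable def betaMoment (n : ℕ) (s : ℝ) : ℝ := ∫ x in (0 : ℝ)..1, x ^ s / (1 + x) ^ n

theorem betaMoment_intervalIntegrable (n : ℕ) {s : ℝ} (hs : 0 ≤ s) :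
    IntervalIntegrable (fun x : ℝ => x ^ s / (1 + x) ^ n) volume 0 1 :=
  (betaMoment_integrand_continuousOn n hs).intervalIntegrable_of_Icc zero_le_one

theorem betaMoment_pos (n : ℕ) {s : ℝ} (hs : 0 ≤ s) : 0 < betaMoment n s := by
  refine intervalIntegral.intervalIntegral_pos_of_pos_on (betaMoment_intervalIntegrable n hs) ?_
    zero_lt_one
  intro x hx
  have := hx.1
  positivity

theorem betaMoment_two_le_one {s : ℝ} (hs : 0 ≤ s) : betaMoment 2 s ≤ betaMoment 1 s := by
  refine intervalIntegral.integral_mono_on zero_le_one (betaMoment_intervalIntegrable 2 hs)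
    (betaMoment_intervalIntegrable 1 hs) ?_
  intro x hx
  have h0 := hx.1
  have : (1 + x) ^ 1 ≤ (1 + x) ^ 2 := pow_le_pow_right₀ (by linarith) (by norm_num)
  gcongr

theorem continuousOn_betaMoment (n : ℕ) : ContinuousOn (betaMoment n) (Set.Ioi 0) := by
  intro s₀ hs₀
  refine ContinuousAt.continuousWithinAt ?_
  refine intervalIntegral.continuousAt_of_dominated_interval (bound := fun _ => 1) ?_ ?_
    (by simp) ?_
  · filter_upwards [Ioi_mem_nhds hs₀] with s hs
    exact (Set.uIoc_of_le (zero_le_one (α := ℝ))) ▸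
      (betaMoment_intervalIntegrable n (le_of_lt hs)).aestronglyMeasurable
  · filter_upwards [Ioi_mem_nhds hs₀] with s hs
    refine Filter.Eventually.of_forall fun x hx => ?_
    rw [Set.uIoc_of_le zero_le_one] at hx
    have h0 := hx.1
    have h1 : x ^ s ≤ 1 := Real.rpow_le_one h0.le hx.2 (le_of_lt hs)
    have h2 : 1 ≤ (1 + x) ^ n := one_le_pow₀ (by linarith)
    rw [Real.norm_of_nonneg (by positivity), div_le_one (by positivity)]
    exact h1.trans h2
  · refine Filter.Eventually.of_forall fun x hx => ?_
    rw [Set.uIoc_of_le zero_le_one] at hx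
    exact (Real.continuousAt_const_rpow hx.1.ne').div_const _

/-- Chebyshev's inequality: the mean of `1 / (1 + x)` with respect to the weight `x ^ s / (1 + x)`
strictly decreases in `s`. -/
theorem betaMoment_mul_lt {a s : ℝ} (ha : 0 ≤ a) (has : a < s) :
    betaMoment 2 s * betaMoment 1 a < betaMoment 2 a * betaMoment 1 s := by
  have hs : 0 ≤ s := ha.trans has.le
  have hA := betaMoment_pos 2 ha
  -- `y` is the mean of `x` for the weight `x^a / (1 + x)^2`, so `(y - x) x^a / (1 + x)^2` has
  -- integral zero. Multiplying by the increasing factor `x^(s - a)` makes the integral negative.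
  set y : ℝ := betaMoment 1 a / betaMoment 2 a - 1 with hy
  have hy0 : 0 ≤ y := by
    rw [hy, sub_nonneg, one_le_div hA]
    exact betaMoment_two_le_one ha
  have hd : 0 < s - a := sub_pos.2 has
  have hyB : (1 + y) * betaMoment 2 a = betaMoment 1 a := by
    rw [hy]; field_simp; ring
  have hint : ∀ {r : ℝ}, 0 ≤ r → ∫ x in (0 : ℝ)..1, ((1 + y) * (x ^ r / (1 + x) ^ 2)
      - x ^ r / (1 + x) ^ 1) = (1 + y) * betaMoment 2 r - betaMoment 1 r := by
    intro r hr
    rw [intervalIntegral.integral_sub ((betaMoment_intervalIntegrable 2 hr).const_mul _)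
      (betaMoment_intervalIntegrable 1 hr), intervalIntegral.integral_const_mul]
    rfl
  have hcont : ∀ {r : ℝ}, 0 ≤ r → ContinuousOn (fun x : ℝ => (1 + y) * (x ^ r / (1 + x) ^ 2)
      - x ^ r / (1 + x) ^ 1) (Set.Icc 0 1) := fun hr =>
    ((betaMoment_integrand_continuousOn 2 hr).const_smul (1 + y)).sub (betaMoment_integrand_continuousOn 1 hr)
  have hdiff : ∀ x : ℝ, 0 < x → y ^ (s - a) * ((1 + y) * (x ^ a / (1 + x) ^ 2)
      - x ^ a / (1 + x) ^ 1) - ((1 + y) * (x ^ s / (1 + x) ^ 2) - x ^ s / (1 + x) ^ 1)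
      = x ^ a / (1 + x) ^ 2 * ((y ^ (s - a) - x ^ (s - a)) * (y - x)) := by
    intro x hx
    have : x ^ s = x ^ a * x ^ (s - a) := by rw [← Real.rpow_add hx]; ring_nf
    rw [this]
    field_simp
    ring
  have hpos : ∀ x : ℝ, 0 < x → x ≠ y → 0 < (y ^ (s - a) - x ^ (s - a)) * (y - x) := by
    intro x hx hxy
    rcases lt_or_gt_of_ne hxy with h | h
    · exact mul_pos (sub_pos.2 (Real.rpow_lt_rpow hx.le h hd)) (sub_pos.2 h)
    · exact mul_pos_of_neg_of_neg (sub_neg.2 (Real.rpow_lt_rpow hy0 h hd)) (sub_neg.2 h)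
  have hcont' : ContinuousOn (fun x : ℝ => y ^ (s - a) * ((1 + y) * (x ^ a / (1 + x) ^ 2)
      - x ^ a / (1 + x) ^ 1)) (Set.Icc 0 1) := (hcont ha).const_smul (y ^ (s - a))
  have key := intervalIntegral.integral_lt_integral_of_continuousOn_of_le_of_exists_lt
    (a := (0 : ℝ)) (b := 1) zero_lt_one (hcont hs)
    hcont' ?_ ?_
  · rw [hint hs, intervalIntegral.integral_const_mul, hint ha, hyB, sub_self, mul_zero] at key
    rw [← hyB]
    nlinarith
  · intro x hx
    have h0 := hx.1
    rw [← sub_nonneg, hdiff x h0]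
    rcases eq_or_ne x y with rfl | h
    · simp
    · have := hpos x h0 h
      positivity
  -- The integrands differ at every `x > 0` other than `y`, so any such point in `(0, 1]` gives
  -- strictness.
  · obtain ⟨x, hx0, hx1, hxy⟩ : ∃ x : ℝ, 0 < x ∧ x ≤ 1 ∧ x ≠ y := by
      rcases eq_or_ne 1 y with h | h
      · exact ⟨1 / 2, by norm_num, by norm_num, by rw [← h]; norm_num⟩
      · exact ⟨1, one_pos, le_rfl, h⟩
    refine ⟨x, ⟨hx0.le, hx1⟩, ?_⟩
    rw [← sub_pos, hdiff x hx0]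
    have := hpos x hx0 hxy
    positivity

/-- Integration by parts: `(1 - x)/(1 + x)` has derivative `-2/(1 + x)^2`, and `x^s (1 - x)/(1 + x)`
vanishes at both endpoints. -/
theorem xi0_eq_two_mul_betaMoment {s : ℝ} (hs : 0 < s) : xi0 s = 2 * betaMoment 2 s := by
  have hI := xiIntegrand_intervalIntegrable s hs
  have hJ := (betaMoment_intervalIntegrable 2 hs.le).const_mul 2
  have hc : ContinuousOn (fun x : ℝ => x ^ s * ((1 - x) / (1 + x))) (Set.Icc 0 1) := by
    refine (Real.continuous_rpow_const hs.le).continuousOn.mul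
      (ContinuousOn.div (by fun_prop) (by fun_prop) ?_)
    intro x hx
    have := hx.1
    positivity
  have h := intervalIntegral.integral_eq_sub_of_hasDerivAt_of_le (zero_le_one (α := ℝ)) hc
    (f' := fun x => xiIntegrand s x - 2 * (x ^ s / (1 + x) ^ 2)) ?_ (hI.sub hJ)
  · rw [intervalIntegral.integral_sub hI hJ, intervalIntegral.integral_const_mul,
      Real.zero_rpow hs.ne'] at h
    norm_num at h
    exact sub_eq_zero.1 h
  · intro x hx
    have h0 := hx.1
    have h1 : (1 : ℝ) + x ≠ 0 := by positivity
    refine ((Real.hasDerivAt_rpow_const (p := s) (Or.inl h0.ne')).mul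
      (((hasDerivAt_id x).const_sub 1).div ((hasDerivAt_id x).const_add 1) h1)).congr_deriv ?_
    simp only [xiIntegrand, Pi.div_apply, id]
    field_simp
    ring

/-- Since `(1 - x)/(1 + x) = 1 - 2x/(1 + x)` and `s x^(s - 1)` has integral 1. -/
theorem one_sub_xi0 {s : ℝ} (hs : 0 < s) : 1 - xi0 s = 2 * s * betaMoment 1 s := by
  have hI : IntervalIntegrable (fun x : ℝ => s * x ^ (s - 1)) volume 0 1 :=
    (intervalIntegral.intervalIntegrable_rpow' (by linarith)).const_mul s
  have hJ := (betaMoment_intervalIntegrable 1 hs.le).const_mul (2 * s)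
  have h1 : xi0 s = ∫ x in (0 : ℝ)..1, (s * x ^ (s - 1) - 2 * s * (x ^ s / (1 + x) ^ 1)) := by
    refine intervalIntegral.integral_congr_ae (Filter.Eventually.of_forall fun x hx => ?_)
    rw [Set.uIoc_of_le zero_le_one] at hx
    have h0 := hx.1
    have : x ^ s = x ^ (s - 1) * x := by
      rw [← Real.rpow_add_one h0.ne']; ring_nf
    rw [this, xiIntegrand]
    field_simp
    ring
  rw [h1, intervalIntegral.integral_sub hI hJ, intervalIntegral.integral_const_mul,
    intervalIntegral.integral_const_mul, integral_rpow (Or.inl (by linarith))]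
  simp only [sub_add_cancel, Real.one_rpow, Real.zero_rpow hs.ne', sub_zero, betaMoment]
  field_simp
  ring

theorem xi0_pos {s : ℝ} (hs : 0 < s) : 0 < xi0 s := by
  have := betaMoment_pos 2 hs.le
  rw [xi0_eq_two_mul_betaMoment hs]
  positivity

theorem xi0_lt_one {s : ℝ} (hs : 0 < s) : xi0 s < 1 := by
  have := betaMoment_pos 1 hs.le
  rw [← sub_pos, one_sub_xi0 hs]
  positivity

theorem continuousOn_xi0_div : ContinuousOn (fun σ : ℝ => xi0 σ / σ) (Set.Ioi 0) := by
  refine ContinuousOn.div ?_ continuousOn_id fun x hx => ne_of_gt hx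
  exact ((continuousOn_betaMoment 2).const_smul (2 : ℝ)).congr
    fun s hs => xi0_eq_two_mul_betaMoment hs

theorem xi0_div_intervalIntegrable {a b : ℝ} (ha : 0 < a) (hb : 0 < b) :
    IntervalIntegrable (fun σ : ℝ => xi0 σ / σ) volume a b :=
  (continuousOn_xi0_div.mono fun _ hx => (lt_min ha hb).trans_le hx.1).intervalIntegrable

/-- Equivalently, `(1 / ξ₀(s) - 1) / s` strictly increases in `s`. -/
theorem xi0_lt_div {a s : ℝ} (ha : 0 < a) (has : a < s) :
    xi0 s < a * xi0 a / (s - (s - a) * xi0 a) := by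
  have hs := ha.trans has
  have hden : 0 < s - (s - a) * xi0 a := by nlinarith [xi0_lt_one ha, xi0_pos ha]
  rw [lt_div_iff₀ hden]
  have h := mul_lt_mul_of_pos_left (betaMoment_mul_lt ha.le has)
    (by positivity : 0 < 4 * a * s)
  have h1 : a * (xi0 a * (1 - xi0 s)) = 4 * a * s * (betaMoment 2 a * betaMoment 1 s) := by
    rw [one_sub_xi0 hs, xi0_eq_two_mul_betaMoment ha]; ring
  have h2 : s * (xi0 s * (1 - xi0 a)) = 4 * a * s * (betaMoment 2 s * betaMoment 1 a) := by
    rw [one_sub_xi0 ha, xi0_eq_two_mul_betaMoment hs]; ring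
  linarith

/-- Forward extremal curves lie strictly above the infinitesimally sharp curve, normalized. -/
theorem one_sub_mul_xi0_lt_exp {a b : ℝ} (ha : 0 < a) (hab : a < b) :
    1 - (1 - a / b) * xi0 a < Real.exp (-∫ σ in a..b, xi0 σ / σ) := by
  have hb := ha.trans hab
  have hk0 := xi0_pos ha
  have hk1 := xi0_lt_one ha
  have hden : ∀ s, a ≤ s → 0 < s - (s - a) * xi0 a := fun s hs => by nlinarith
  have hcont : ContinuousOn (fun s => a * xi0 a / (s - (s - a) * xi0 a) / s) (Set.Icc a b) := by
    refine ((continuousOn_const.div (by fun_prop) fun s hs => (hden s hs.1).ne').div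
      continuousOn_id fun s hs => (ha.trans_le hs.1).ne')
  have hlt := intervalIntegral.integral_lt_integral_of_continuousOn_of_le_of_exists_lt hab
    (continuousOn_xi0_div.mono fun x hx => ha.trans_le hx.1) hcont
    (fun s hs => (div_lt_div_of_pos_right (xi0_lt_div ha hs.1) (ha.trans hs.1)).le)
    ⟨b, ⟨hab.le, le_rfl⟩, div_lt_div_of_pos_right (xi0_lt_div ha hab) hb⟩
  -- Partial fractions give an explicit primitive of the comparison function divided by `s`; it
  -- vanishes at `s = a` up to the constant `-log a + log a`.
  have hderiv : ∀ s ∈ Set.uIcc a b,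
      HasDerivAt (fun s => Real.log s - Real.log (s - (s - a) * xi0 a))
        (a * xi0 a / (s - (s - a) * xi0 a) / s) s := by
    intro s hs
    rw [Set.uIcc_of_le hab.le] at hs
    have hs0 : s ≠ 0 := (ha.trans_le hs.1).ne'
    have hd := (hden s hs.1).ne'
    have hl : HasDerivAt (fun s => s - (s - a) * xi0 a) (1 - 1 * xi0 a) s :=
      (hasDerivAt_id s).sub (((hasDerivAt_id s).sub_const a).mul_const (xi0 a))
    refine ((Real.hasDerivAt_log hs0).sub (hl.log hd)).congr_deriv ?_
    rw [div_div, inv_eq_one_div, div_sub_div _ _ hs0 hd, div_eq_div_iff (mul_ne_zero hs0 hd)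
      (mul_ne_zero hd hs0)]
    ring
  rw [intervalIntegral.integral_eq_sub_of_hasDerivAt hderiv
    (hcont.intervalIntegrable_of_Icc hab.le), sub_self, zero_mul, sub_zero, sub_self,
    sub_zero, ← Real.log_div hb.ne' (hden b hab.le).ne'] at hlt
  have hq : 1 - (1 - a / b) * xi0 a = (b / (b - (b - a) * xi0 a))⁻¹ := by
    rw [inv_div]; field_simp
  rw [hq, ← Real.exp_log (inv_pos.2 (div_pos hb (hden b hab.le))), Real.log_inv]
  exact Real.exp_lt_exp.2 (neg_lt_neg hlt)

theorem theorem4p1 (P₀ : ℝ × ℝ) (hP₀ : P₀ ∈ OmegaSet) (hs₀ : 0 < P₀.1) :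
    (∀ s : ℝ, 0 < s → IntervalIntegrable (fun σ : ℝ => xi0 σ / σ) MeasureTheory.volume P₀.1 s) ∧
    (∀ s : ℝ, P₀.1 < s → tSharp P₀ s < tForward P₀ s) ∧
    (∀ s : ℝ, 0 < s → s < P₀.1 →
      (∃! t : ℝ, IsBackwardValue P₀ s t) ∧
      ∀ t : ℝ, IsBackwardValue P₀ s t → t < tSharp P₀ s) := by
  have hu : 0 < 1 - P₀.2 := sub_pos.2 hP₀.2.2
  refine ⟨fun s hs => xi0_div_intervalIntegrable hs₀ hs, fun s hs => ?_, fun s hs hss => ?_⟩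
  · have h := mul_lt_mul_of_pos_left (one_sub_mul_xi0_lt_exp hs₀ hs) hu
    unfold tSharp tForward
    linarith
  · set c := 1 - (1 - s / P₀.1) * xi0 s with hc
    have hc0 : 0 < c := by
      have h1 : 0 < s / P₀.1 := div_pos hs hs₀
      have h2 : s / P₀.1 < 1 := (div_lt_one hs₀).2 hss
      nlinarith [xi0_pos hs, xi0_lt_one hs]
    -- The equation is affine in `1 - t` with slope `c > 0`, hence uniquely solvable.
    have hiff : ∀ t, IsBackwardValue P₀ s t ↔ t = 1 - (1 - P₀.2) / c := by
      intro t
      have : IsBackwardValue P₀ s t ↔ (1 - t) * c = 1 - P₀.2 := by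
        unfold IsBackwardValue
        constructor <;> intro h <;> linarith
      rw [this, ← eq_div_iff hc0.ne']
      constructor <;> intro h <;> linarith
    refine ⟨⟨_, (hiff _).2 rfl, fun t ht => (hiff t).1 ht⟩, fun t ht => ?_⟩
    rw [(hiff t).1 ht, tSharp, sub_lt_sub_iff_left, div_eq_mul_inv]
    refine mul_lt_mul_of_pos_left ?_ hu
    -- Reversing the integral turns the goal into the reciprocal of the forward inequality from `s`
    -- to `s₀`, whose left side is `c`.
    rw [Real.exp_neg, intervalIntegral.integral_symm, Real.exp_neg, inv_inv]
    have h := one_sub_mul_xi0_lt_exp hs hss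
    rw [Real.exp_neg] at h
    exact (lt_inv_comm₀ hc0 (Real.exp_pos _)).1 h
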